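/- Let $\alpha=(1+\sqrt5)/2$ and $\beta=(1-\sqrt5)/2$. The dual Wythoff array $(D_{i,j})_{i,j\ge1}$ of positive integers is defined row by row: $D_{i,1}$ is the smallest positive integer that occurs in none of the rows $1,\dots,i-1$ (so $D_{1,1}=1$), $D_{i,2}=\lfloor \alpha D_{i,1}+\beta^2\rfloor$, and $D_{i,j}=D_{i,j-1}+D_{i,j-2}$ for $j\ge3$. The classification sequence of an array $(A_{i,j})_{i,j\ge1}$ of non-negative integers is $\delta_i=A_{i,2}-\lfloor\alpha A_{i,1}\rfloor$, $i\ge 1$. Then: (a) The classification sequence of $D$ is $\delta_1=1$ and $\delta_i=0$ for all $i\ge2$. (b) For all $i\ge1$, $$D_{i,1}=\begin{cases}\lfloor i\alpha\rfloor+i, & \text{if there exists } k\ge1 \text{ such that } i=\lfloor k\alpha\rfloor+k+1;\\ \lfloor i\alpha\rfloor+i-1, & \text{otherwise.}\end{cases}$$ Consequently the definition of $D$ agrees with Kimberling's description. That is, for every array $(A_{i,j})_{i,j\ge1}$ of non-negative integers, each of the following two conditions holds if and only if $A_{i,j}=D_{i,j}$ for all $i,j\ge1$: (i) $A_{i,j}=A_{i,j-1}+A_{i,j-2}$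 for all $i\ge1$, $j\ge3$; each $A_{i,1}$ is the smallest positive integer that occurs in none of the rows $1,\dots,i-1$ of $A$; and the classification sequence of $A$ is $1,0,0,0,\dots$. (ii) $A_{i,j}=A_{i,j-1}+A_{i,j-2}$ for all $i\ge1$, $j\ge3$; the first column $A_{i,1}$ is given by the formula in (b); and the classification sequence of $A$ is $1,0,0,0,\dots$. -/

import Mathlib

/-- The generalized Fibonacci sequence with first term `a` and second term `b`,
indexed from `1`; the value at index `0` is a placeholder that is never used. -/
def genFib (a b : ℕ) : ℕ → ℕ
  | 0 => 0
  | 1 => a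
  | 2 => b
  | n + 3 => genFib a b (n + 2) + genFib a b (n + 1)

/-- The smallest positive integer that is not in `S`. -/
noncomputable def mexPos (S : Set ℕ) : ℕ :=
  sInf {x : ℕ | 1 ≤ x ∧ x ∉ S}

/-- The first column of the array determined by `f` (rows indexed from `1`): its `i`-th term is the
smallest positive integer that occurs in no row `i'` with `1 ≤ i' < i`, where row `i'` is the
generalized Fibonacci sequence that starts with `a`, `f a`, for `a` the `i'`-th term
of the first column. -/
noncomputable def firstColumn (f : ℕ → ℕ) (i : ℕ) : ℕ :=
  mexPos {x : ℕ | ∃ i' : ℕ, 1 ≤ i' ∧ ∃ _ : i' < i, ∃ j : ℕ, 1 ≤ j ∧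
    x = genFib (firstColumn f i') (f (firstColumn f i')) j}
termination_by i

/-- The array determined by `f`, with rows and columns indexed from `1`. -/
noncomputable def stolarskyArray (f : ℕ → ℕ) (i j : ℕ) : ℕ :=
  genFib (firstColumn f i) (f (firstColumn f i)) j

/-- The dual Wythoff array: `f n = ⌊α n + β ^ 2⌋` with `α = (1 + √5) / 2`, `β = (1 - √5) / 2`. -/
noncomputable def dualWythoff : ℕ → ℕ → ℕ :=
  stolarskyArray fun n => ⌊Real.goldenRatio * (n : ℝ) + Real.goldenConj ^ 2⌋₊

/-- The classification sequence `δ i = A i 2 - ⌊α * A i 1⌋` of an array. -/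
noncomputable def classificationSeq (A : ℕ → ℕ → ℕ) (i : ℕ) : ℤ :=
  (A i 2 : ℤ) - ⌊Real.goldenRatio * (A i 1 : ℝ)⌋

/-- Every row is a generalized Fibonacci sequence. -/
def HasFibonacciRows (A : ℕ → ℕ → ℕ) : Prop :=
  ∀ i j : ℕ, 1 ≤ i → 3 ≤ j → A i j = A i (j - 1) + A i (j - 2)

/-- Every term of the first column is the smallest positive integer in no preceding row. -/
def HasMexFirstColumn (A : ℕ → ℕ → ℕ) : Prop :=
  ∀ i : ℕ, 1 ≤ i →
    IsLeast {x : ℕ | 1 ≤ x ∧ ∀ i' j : ℕ, 1 ≤ i' → i' < i → 1 ≤ j → x ≠ A i' j} (A i 1)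

/-- The classification sequence is `1, 0, 0, 0, …`. -/
def HasDualClassification (A : ℕ → ℕ → ℕ) : Prop :=
  classificationSeq A 1 = 1 ∧ ∀ i : ℕ, 2 ≤ i → classificationSeq A i = 0

/-- The first column is `⌊i α⌋ + i` if `i = ⌊k α⌋ + k + 1` for some `k ≥ 1`, and
`⌊i α⌋ + i - 1` otherwise. -/
def HasDualFirstColumn (A : ℕ → ℕ → ℕ) : Prop :=
  ∀ i : ℕ, 1 ≤ i →
    ((∃ k : ℕ, 1 ≤ k ∧ (i : ℤ) = ⌊(k : ℝ) * Real.goldenRatio⌋ + k + 1) →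
      (A i 1 : ℤ) = ⌊(i : ℝ) * Real.goldenRatio⌋ + i) ∧
    ((¬ ∃ k : ℕ, 1 ≤ k ∧ (i : ℤ) = ⌊(k : ℝ) * Real.goldenRatio⌋ + k + 1) →
      (A i 1 : ℤ) = ⌊(i : ℝ) * Real.goldenRatio⌋ + i - 1)

/-! Since β² = 2 − α, the map s(n) = ⌊αn + 2 − α⌋ satisfies s(s(n)) = s(n) + n, so every row of the
array is an orbit of s. As s(n) > n for n ≥ 1, descending along s from a positive integer ends at a
positive integer that s misses, and the mex rule lists exactly these in increasing order. Because
1/α + 1/α² = 1, they form a shifted Beatty sequence of slope α² (`dualGap`), which makes (a) and (b)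
floor computations. Both of Kimberling's conditions then determine the first two columns, hence the
array. -/

open Real in
theorem goldenRatio_bounds : 3 / 2 < goldenRatio ∧ goldenRatio < 5 / 3 := by
  have h := goldenRatio_sq
  have h0 := goldenRatio_pos
  constructor <;> nlinarith

theorem goldenConj_sq_eq : Real.goldenConj ^ 2 = 2 - Real.goldenRatio := by
  rw [Real.goldenConj_sq, ← Real.one_sub_goldenRatio]
  ring

/-- An integral multiple of the golden ratio is an integer only if the multiplier is zero. -/
theorem eq_zero_of_intCast_mul_goldenRatio {a b : ℤ} (h : (a : ℝ) * Real.goldenRatio = b) :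
    a = 0 := by
  by_contra ha
  exact (Real.goldenRatio_irrational.intCast_mul ha).ne_int b h

/-! ### The successor map along rows -/

/-- The successor function along the rows of the dual Wythoff array. -/
noncomputable def dualSucc (n : ℕ) : ℕ :=
  ⌊Real.goldenRatio * (n : ℝ) + Real.goldenConj ^ 2⌋₊

theorem dualSucc_eq_iff {n m : ℕ} :
    dualSucc n = m ↔ (m : ℝ) ≤ Real.goldenRatio * n + 2 - Real.goldenRatio ∧
      Real.goldenRatio * n + 2 - Real.goldenRatio < m + 1 := by
  have hb := goldenRatio_bounds
  have hn : (0 : ℝ) ≤ Real.goldenRatio * n := by positivity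
  rw [dualSucc, goldenConj_sq_eq, Nat.floor_eq_iff (by linarith), ← add_sub_assoc]

theorem dualSucc_bounds (n : ℕ) :
    (dualSucc n : ℝ) ≤ Real.goldenRatio * n + 2 - Real.goldenRatio ∧
      Real.goldenRatio * n + 2 - Real.goldenRatio < dualSucc n + 1 :=
  dualSucc_eq_iff.1 rfl

theorem lt_dualSucc {n : ℕ} (hn : 1 ≤ n) : n < dualSucc n := by
  have hb := goldenRatio_bounds
  have hn' : (1 : ℝ) ≤ n := by exact_mod_cast hn
  have h := (dualSucc_bounds n).2
  have : (n : ℝ) < dualSucc n := by nlinarith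
  exact_mod_cast this

/-- If θ is the fractional part of αn + 2 − α and s = `dualSucc n`, then αs + 2 − α exceeds s + n by
(α − 1)(1 − θ), which lies in (0, 1). -/
theorem dualSucc_dualSucc (n : ℕ) : dualSucc (dualSucc n) = dualSucc n + n := by
  have hb := goldenRatio_bounds
  have hs := Real.goldenRatio_sq
  obtain ⟨h1, h2⟩ := dualSucc_bounds n
  rw [dualSucc_eq_iff]
  push_cast
  constructor <;> nlinarith

theorem dualSucc_one : dualSucc 1 = 2 := by
  rw [dualSucc_eq_iff]
  constructor <;> push_cast <;> linarith

theorem genFib_dualSucc_succ (a j : ℕ) :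
    genFib a (dualSucc a) (j + 2) = dualSucc (genFib a (dualSucc a) (j + 1)) := by
  induction j with
  | zero => rfl
  | succ j ih =>
    change genFib a (dualSucc a) (j + 2) + genFib a (dualSucc a) (j + 1) = _
    rw [ih, dualSucc_dualSucc]

/-! ### The complementary Beatty sequence -/

/-- The increasing enumeration of the positive integers that are not values of `dualSucc`. -/
noncomputable def dualGap (i : ℕ) : ℕ :=
  ⌈(Real.goldenRatio + 1) * (i : ℝ) + 1 - Real.goldenRatio⌉₊ - 1

/-- The strict and weak bounds are swapped relative to `dualSucc_eq_iff`: at i = 1 the expression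
equals 2, so a floor would give 2 instead of 1. -/
theorem dualGap_eq_iff {i m : ℕ} (hi : 1 ≤ i) :
    dualGap i = m ↔ (m : ℝ) < (Real.goldenRatio + 1) * i + 1 - Real.goldenRatio ∧
      (Real.goldenRatio + 1) * i + 1 - Real.goldenRatio ≤ m + 1 := by
  have hb := goldenRatio_bounds
  have hi' : (1 : ℝ) ≤ i := by exact_mod_cast hi
  have hx : 1 < ⌈(Real.goldenRatio + 1) * (i : ℝ) + 1 - Real.goldenRatio⌉₊ := by
    rw [Nat.lt_ceil]
    push_cast
    nlinarith
  have h : dualGap i = m ↔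
      ⌈(Real.goldenRatio + 1) * (i : ℝ) + 1 - Real.goldenRatio⌉₊ = m + 1 := by
    unfold dualGap
    omega
  rw [h, Nat.ceil_eq_iff (by omega)]
  push_cast
  simp

theorem dualGap_bounds {i : ℕ} (hi : 1 ≤ i) :
    (dualGap i : ℝ) < (Real.goldenRatio + 1) * i + 1 - Real.goldenRatio ∧
      (Real.goldenRatio + 1) * i + 1 - Real.goldenRatio ≤ dualGap i + 1 :=
  (dualGap_eq_iff hi).1 rfl

theorem dualGap_one : dualGap 1 = 1 := by
  have hb := goldenRatio_bounds
  rw [dualGap_eq_iff le_rfl]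
  constructor <;> push_cast <;> linarith

/-- The upper bound in `dualGap_bounds` is attained only at `1`. -/
theorem dualGap_lt {i : ℕ} (hi : 2 ≤ i) :
    (Real.goldenRatio + 1) * i + 1 - Real.goldenRatio < dualGap i + 1 := by
  refine lt_of_le_of_ne (dualGap_bounds (by omega)).2 fun h => ?_
  have := eq_zero_of_intCast_mul_goldenRatio (a := (i : ℤ) - 1) (b := (dualGap i : ℤ) - i) (by
    push_cast
    linarith)
  omega

theorem one_le_dualGap {i : ℕ} (hi : 1 ≤ i) : 1 ≤ dualGap i := by
  have hb := goldenRatio_bounds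
  have hi' : (1 : ℝ) ≤ i := by exact_mod_cast hi
  have h := (dualGap_bounds hi).2
  have : (0 : ℝ) < dualGap i := by nlinarith
  exact_mod_cast this

theorem dualGap_lt_dualGap {i k : ℕ} (hi : 1 ≤ i) (hik : i < k) : dualGap i < dualGap k := by
  have hb := goldenRatio_bounds
  have hik' : (i : ℝ) + 1 ≤ k := by exact_mod_cast hik
  have h1 := (dualGap_bounds hi).1
  have h2 := (dualGap_bounds (hi.trans hik.le)).2
  have : (dualGap i : ℝ) < dualGap k := by nlinarith
  exact_mod_cast this

theorem dualGap_ne_dualSucc {i : ℕ} (hi : 1 ≤ i) (n : ℕ) : dualGap i ≠ dualSucc n := by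
  intro h
  have hb := goldenRatio_bounds
  have hs := Real.goldenRatio_sq
  obtain ⟨h1, h2⟩ := dualGap_bounds hi
  obtain ⟨h3, h4⟩ := dualSucc_bounds n
  rw [← h] at h3 h4
  generalize dualGap i = m at *
  -- Divide the bounds on m by α² and by α and add: 1/α + 1/α² = 1 and the shifts cancel.
  have hlow : (m : ℝ) < n + i := by nlinarith
  have hupp : (n + i : ℝ) < m + 1 := by nlinarith
  have hlow' : m < n + i := by exact_mod_cast hlow
  have hupp' : n + i < m + 1 := by exact_mod_cast hupp
  omega

/-- Every positive integer is a value of `dualSucc` or of `dualGap`. -/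
theorem exists_dualSucc_or_dualGap {m : ℕ} (hm : 1 ≤ m) :
    (∃ n, 1 ≤ n ∧ dualSucc n = m) ∨ ∃ i, 1 ≤ i ∧ dualGap i = m := by
  have hb := goldenRatio_bounds
  have hs := Real.goldenRatio_sq
  have hm' : (1 : ℝ) ≤ m := by exact_mod_cast hm
  -- `dualSucc n = m` means L ≤ n < L + 1/α, where 1/α = α − 1. If the least integer n ≥ L misses
  -- this window, m is the gap of index m − n + 1.
  set L : ℝ := Real.goldenRatio * m - m - 2 * Real.goldenRatio + 3 with hL
  have hL0 : 0 < L := by nlinarith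
  have hn1 : 1 ≤ ⌈L⌉₊ := Nat.ceil_pos.2 hL0
  have hn2 : L ≤ ⌈L⌉₊ := Nat.le_ceil L
  have hn3 : (⌈L⌉₊ : ℝ) < L + 1 := Nat.ceil_lt_add_one hL0.le
  generalize ⌈L⌉₊ = n at *
  by_cases hn : (n : ℝ) < L + Real.goldenRatio - 1
  · refine Or.inl ⟨n, hn1, ?_⟩
    rw [dualSucc_eq_iff]
    constructor <;> nlinarith
  · push Not at hn
    have hnm : n ≤ m := by
      have : (n : ℝ) < m + 1 := by nlinarith
      exact Nat.lt_succ_iff.1 (by exact_mod_cast this)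
    obtain ⟨i, rfl⟩ := Nat.exists_eq_add_of_le hnm
    refine Or.inr ⟨i + 1, by omega, ?_⟩
    rw [dualGap_eq_iff (by omega)]
    push_cast at *
    constructor <;> nlinarith

/-- Every positive integer occurs in a row that starts with a value of `dualGap`. -/
theorem exists_eq_genFib_dualGap (x : ℕ) (hx : 1 ≤ x) :
    ∃ i j, 1 ≤ i ∧ dualGap i ≤ x ∧ x = genFib (dualGap i) (dualSucc (dualGap i)) (j + 1) := by
  induction x using Nat.strong_induction_on with
  | _ x ih =>
    rcases exists_dualSucc_or_dualGap hx with ⟨n, hn, rfl⟩ | ⟨i, hi, rfl⟩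
    · obtain ⟨i, j, hi, hle, h⟩ := ih n (lt_dualSucc hn) hn
      exact ⟨i, j + 1, hi, hle.trans (lt_dualSucc hn).le, by rw [genFib_dualSucc_succ, ← h]⟩
    · exact ⟨i, 0, hi, le_rfl, rfl⟩

theorem isLeast_dualGap {i : ℕ} (hi : 1 ≤ i) :
    IsLeast {x : ℕ | 1 ≤ x ∧ ∀ i' j : ℕ, 1 ≤ i' → i' < i → 1 ≤ j →
      x ≠ genFib (dualGap i') (dualSucc (dualGap i')) j} (dualGap i) := by
  constructor
  · refine ⟨one_le_dualGap hi, fun i' j hi' hlt hj => ?_⟩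
    match j, hj with
    | 1, _ => exact (dualGap_lt_dualGap hi' hlt).ne'
    | j + 2, _ =>
      rw [genFib_dualSucc_succ]
      exact dualGap_ne_dualSucc hi _
  · rintro x ⟨hx, h⟩
    obtain ⟨k, j, hk, hle, hxk⟩ := exists_eq_genFib_dualGap x hx
    rcases lt_trichotomy k i with hki | rfl | hki
    · exact absurd hxk (h k (j + 1) hk hki (by omega))
    · exact hle
    · exact (dualGap_lt_dualGap hi hki).le.trans hle

theorem firstColumn_dualSucc (i : ℕ) (hi : 1 ≤ i) : firstColumn dualSucc i = dualGap i := by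
  induction i using Nat.strong_induction_on with
  | _ i ih =>
    rw [firstColumn, mexPos, ← (isLeast_dualGap hi).csInf_eq]
    congr 1
    ext x
    refine and_congr_right fun _ => ?_
    constructor
    · intro h i' j hi' hlt hj hx
      exact h ⟨i', hi', hlt, j, hj, by rw [ih i' hlt hi']; exact hx⟩
    · rintro h ⟨i', hi', hlt, j, hj, hx⟩
      rw [ih i' hlt hi'] at hx
      exact h i' j hi' hlt hj hx

/-! ### Classification and first column of the array -/

theorem dualWythoff_eq {i : ℕ} (hi : 1 ≤ i) (j : ℕ) :
    dualWythoff i j = genFib (dualGap i) (dualSucc (dualGap i)) j := by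
  rw [← firstColumn_dualSucc i hi]
  rfl

theorem hasFibonacciRows_dualWythoff : HasFibonacciRows dualWythoff := by
  intro i j _ hj
  obtain ⟨j, rfl⟩ := Nat.exists_eq_add_of_le' hj
  rfl

theorem hasMexFirstColumn_dualWythoff : HasMexFirstColumn dualWythoff := by
  intro i hi
  rw [dualWythoff_eq hi]
  simp only [genFib]
  convert isLeast_dualGap hi using 1
  ext x
  refine and_congr_right fun _ => forall_congr' fun i' => forall_congr' fun j =>
    forall_congr' fun hi' => ?_
  rw [dualWythoff_eq hi']

theorem hasDualClassification_dualWythoff : HasDualClassification dualWythoff := by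
  have hb := goldenRatio_bounds
  have hs := Real.goldenRatio_sq
  constructor
  · have hfloor : ⌊Real.goldenRatio * ((1 : ℕ) : ℝ)⌋ = 1 := by
      rw [Int.floor_eq_iff]
      constructor <;> push_cast <;> linarith
    rw [classificationSeq, dualWythoff_eq le_rfl, dualWythoff_eq le_rfl]
    simp only [genFib, dualGap_one, dualSucc_one, hfloor]
    norm_num
  · intro i hi
    have hi1 : 1 ≤ i := by omega
    rw [classificationSeq, dualWythoff_eq hi1, dualWythoff_eq hi1, sub_eq_zero, eq_comm,
      Int.floor_eq_iff]
    simp only [genFib, Int.cast_natCast]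
    have h1 := (dualGap_bounds hi1).1
    have h2 := dualGap_lt hi
    obtain ⟨h3, h4⟩ := dualSucc_bounds (dualGap i)
    generalize dualSucc (dualGap i) = s at *
    generalize dualGap i = m at *
    -- Dividing the strict bounds on m by α² gives 2α − 3 < αm − (2m − i) < α − 1, so s and ⌊αm⌋
    -- both equal 2m − i. At i = 1 the upper bound is attained and s is one larger.
    have hlow : (s : ℝ) < 2 * m - i + 1 := by nlinarith
    have hupp : (2 * m - i : ℝ) - 1 < s := by nlinarith
    have hlow' : (s : ℤ) < 2 * m - i + 1 := by exact_mod_cast hlow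
    have hupp' : (2 * m - i : ℤ) - 1 < s := by exact_mod_cast hupp
    have hsm : (s : ℤ) = 2 * m - i := by omega
    have hsm' : (s : ℝ) = 2 * m - i := by exact_mod_cast hsm
    constructor <;> nlinarith

/-- The two cases record whether the fractional part of iα exceeds α − 1. When it does, k = 2i − 1 −
⌊iα⌋. -/
theorem hasDualFirstColumn_dualWythoff : HasDualFirstColumn dualWythoff := by
  have hb := goldenRatio_bounds
  have hs := Real.goldenRatio_sq
  intro i hi
  have hi' : (1 : ℝ) ≤ i := by exact_mod_cast hi
  rw [dualWythoff_eq hi]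
  simp only [genFib]
  obtain ⟨h1, h2⟩ := dualGap_bounds hi
  constructor
  · rintro ⟨k, hk, hik⟩
    have hk' : (1 : ℝ) ≤ k := by exact_mod_cast hk
    have hfl : ⌊(k : ℝ) * Real.goldenRatio⌋ = (i : ℤ) - k - 1 := by omega
    rw [Int.floor_eq_iff] at hfl
    push_cast at hfl
    obtain ⟨h3, h4⟩ := hfl
    have hi2 : 2 ≤ i := by
      have : (1 : ℝ) < i := by nlinarith
      exact_mod_cast this
    have h5 := dualGap_lt hi2
    generalize dualGap i = m at *
    have e1 : (i : ℝ) * Real.goldenRatio < 2 * i - k := by nlinarith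
    have e2 : (2 * i - k - 1 : ℝ) + (Real.goldenRatio - 1) ≤ i * Real.goldenRatio := by nlinarith
    have hlow : (m - i : ℝ) < 2 * i - k := by linarith
    have hupp : (2 * i - k - 1 : ℝ) < m - i + 1 := by linarith
    have hlow' : (m - i : ℤ) < 2 * i - k := by exact_mod_cast hlow
    have hupp' : (2 * i - k - 1 : ℤ) < m - i + 1 := by exact_mod_cast hupp
    have hm : (m : ℤ) - i = 2 * i - k - 1 := by omega
    have hm' : (m : ℝ) - i = 2 * i - k - 1 := by exact_mod_cast hm
    rw [← sub_eq_iff_eq_add, eq_comm, Int.floor_eq_iff]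
    push_cast
    constructor <;> linarith
  · intro hne
    have hfl : ⌊(i : ℝ) * Real.goldenRatio⌋ = (dualGap i : ℤ) - i + 1 := by
      rw [Int.floor_eq_iff]
      push_cast
      refine ⟨?_, by linarith⟩
      by_contra! h
      apply hne
      generalize dualGap i = m at *
      -- Here ⌊iα⌋ = m − i, so 3i − m − 1 is the required k.
      have hk : (0 : ℝ) < 3 * i - m - 1 := by nlinarith
      have hk' : (0 : ℤ) < 3 * i - m - 1 := by exact_mod_cast hk
      obtain ⟨k, hkm⟩ := Int.eq_ofNat_of_zero_le hk'.le
      have hkm' : (3 * i - m - 1 : ℝ) = k := by exact_mod_cast hkm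
      refine ⟨k, by omega, ?_⟩
      have : ⌊(k : ℝ) * Real.goldenRatio⌋ = (i : ℤ) - k - 1 := by
        rw [Int.floor_eq_iff]
        push_cast
        rw [← hkm']
        constructor <;> nlinarith
      omega
    omega

/-! ### Uniqueness -/

/-- An array with Fibonacci rows is determined by its first two columns. -/
theorem HasFibonacciRows.row_ext {A B : ℕ → ℕ → ℕ} (hA : HasFibonacciRows A)
    (hB : HasFibonacciRows B) {i : ℕ} (hi : 1 ≤ i) (h1 : A i 1 = B i 1) (h2 : A i 2 = B i 2)
    (j : ℕ) (hj : 1 ≤ j) : A i j = B i j := by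
  induction j using Nat.strong_induction_on with
  | _ j ih =>
    match j, hj with
    | 1, _ => exact h1
    | 2, _ => exact h2
    | j + 3, _ =>
      rw [hA i (j + 3) hi (by omega), hB i (j + 3) hi (by omega),
        ih (j + 3 - 1) (by omega) (by omega), ih (j + 3 - 2) (by omega) (by omega)]

/-- The first column and the classification sequence determine the second column. -/
theorem HasDualClassification.second_eq {A B : ℕ → ℕ → ℕ} (hA : HasDualClassification A)
    (hB : HasDualClassification B) {i : ℕ} (hi : 1 ≤ i) (h1 : A i 1 = B i 1) :
    A i 2 = B i 2 := by
  have h : classificationSeq A i = classificationSeq B i := by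
    rcases hi.eq_or_lt with rfl | hi
    · rw [hA.1, hB.1]
    · rw [hA.2 i hi, hB.2 i hi]
  unfold classificationSeq at h
  rw [h1] at h
  omega

theorem HasMexFirstColumn.first_eq {A B : ℕ → ℕ → ℕ} (hA : HasMexFirstColumn A)
    (hB : HasMexFirstColumn B) {i : ℕ} (hi : 1 ≤ i)
    (h : ∀ i' j, 1 ≤ i' → i' < i → 1 ≤ j → A i' j = B i' j) : A i 1 = B i 1 := by
  obtain ⟨⟨h1, hne⟩, hle⟩ := hB i hi
  refine (hA i hi).unique ⟨⟨h1, fun i' j hi' hlt hj => ?_⟩, fun x hx => hle ⟨hx.1, ?_⟩⟩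
  · rw [h i' j hi' hlt hj]
    exact hne i' j hi' hlt hj
  · intro i' j hi' hlt hj
    rw [← h i' j hi' hlt hj]
    exact hx.2 i' j hi' hlt hj

theorem HasDualFirstColumn.first_eq {A B : ℕ → ℕ → ℕ} (hA : HasDualFirstColumn A)
    (hB : HasDualFirstColumn B) {i : ℕ} (hi : 1 ≤ i) : A i 1 = B i 1 := by
  by_cases h : ∃ k : ℕ, 1 ≤ k ∧ (i : ℤ) = ⌊(k : ℝ) * Real.goldenRatio⌋ + k + 1
  · have h1 := (hA i hi).1 h
    have h2 := (hB i hi).1 h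
    omega
  · have h1 := (hA i hi).2 h
    have h2 := (hB i hi).2 h
    omega

section Congr

variable {A B : ℕ → ℕ → ℕ}

theorem HasFibonacciRows.congr (hB : HasFibonacciRows B)
    (h : ∀ i j, 1 ≤ i → 1 ≤ j → A i j = B i j) : HasFibonacciRows A := by
  intro i j hi hj
  rw [h i j hi (by omega), h i (j - 1) hi (by omega), h i (j - 2) hi (by omega)]
  exact hB i j hi hj

theorem HasMexFirstColumn.congr (hB : HasMexFirstColumn B)
    (h : ∀ i j, 1 ≤ i → 1 ≤ j → A i j = B i j) : HasMexFirstColumn A := by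
  intro i hi
  rw [h i 1 hi le_rfl]
  convert hB i hi using 1
  ext x
  refine and_congr_right fun _ => forall_congr' fun i' => forall_congr' fun j =>
    forall_congr' fun hi' => forall_congr' fun _ => forall_congr' fun hj => ?_
  rw [h i' j hi' hj]

theorem HasDualClassification.congr (hB : HasDualClassification B)
    (h : ∀ i j, 1 ≤ i → 1 ≤ j → A i j = B i j) : HasDualClassification A := by
  have hc : ∀ i, 1 ≤ i → classificationSeq A i = classificationSeq B i := fun i hi => by
    rw [classificationSeq, classificationSeq, h i 1 hi (by omega), h i 2 hi (by omega)]
  exact ⟨(hc 1 le_rfl).trans hB.1, fun i hi => (hc i (by omega)).trans (hB.2 i hi)⟩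

theorem HasDualFirstColumn.congr (hB : HasDualFirstColumn B)
    (h : ∀ i j, 1 ≤ i → 1 ≤ j → A i j = B i j) : HasDualFirstColumn A := by
  intro i hi
  rw [h i 1 hi le_rfl]
  exact hB i hi

end Congr

/-- The first two conjuncts are the classification sequence and the first column of the dual
Wythoff array. The last two say that each of Kimberling's descriptions (classification sequence
with the mex rule; classification sequence with the explicit first column) determines, among
arrays with Fibonacci rows, exactly the dual Wythoff array. -/
theorem theorem10 :
    HasDualClassification dualWythoff ∧
    HasDualFirstColumn dualWythoff ∧
    (∀ A : ℕ → ℕ → ℕ,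
      (HasFibonacciRows A ∧ HasMexFirstColumn A ∧ HasDualClassification A) ↔
        ∀ i j : ℕ, 1 ≤ i → 1 ≤ j → A i j = dualWythoff i j) ∧
    (∀ A : ℕ → ℕ → ℕ,
      (HasFibonacciRows A ∧ HasDualFirstColumn A ∧ HasDualClassification A) ↔
        ∀ i j : ℕ, 1 ≤ i → 1 ≤ j → A i j = dualWythoff i j) := by
  refine ⟨hasDualClassification_dualWythoff, hasDualFirstColumn_dualWythoff,
    fun A => ⟨?_, fun h => ⟨hasFibonacciRows_dualWythoff.congr h,
      hasMexFirstColumn_dualWythoff.congr h, hasDualClassification_dualWythoff.congr h⟩⟩,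
    fun A => ⟨?_, fun h => ⟨hasFibonacciRows_dualWythoff.congr h,
      hasDualFirstColumn_dualWythoff.congr h, hasDualClassification_dualWythoff.congr h⟩⟩⟩
  -- The mex of row i depends on all earlier rows, hence strong induction on whole rows.
  · rintro ⟨hrows, hmex, hcls⟩ i
    induction i using Nat.strong_induction_on with
    | _ i ih =>
      intro j hi hj
      have h1 := hmex.first_eq hasMexFirstColumn_dualWythoff hi
        fun i' j' hi' hlt hj' => ih i' hlt j' hi' hj'
      exact hrows.row_ext hasFibonacciRows_dualWythoff hi h1
        (hcls.second_eq hasDualClassification_dualWythoff hi h1) j hj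
  · rintro ⟨hrows, hfirst, hcls⟩ i j hi hj
    have h1 := hfirst.first_eq hasDualFirstColumn_dualWythoff hi
    exact hrows.row_ext hasFibonacciRows_dualWythoff hi h1
      (hcls.second_eq hasDualClassification_dualWythoff hi h1) j hj
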